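/- A ribbon graph $G$ is a surface with boundary that is the union of finitely many vertex-discs (forming the set $V(G)$) and finitely many edge-discs (forming the set $E(G)$), such that vertices and edges intersect in disjoint line segments, each segment lies on the boundary of exactly one vertex and exactly one edge, and every edge contains exactly two segments. Ribbon graphs are considered up to homeomorphism preserving this structure. Let $v(G),e(G),f(G),c(G)$ be the numbers of vertices, edges, boundary components and connected components of $G$, and let $\varepsilon(G)=2c(G)-\bigl(v(G)-e(G)+f(G)\bigr)$ be its Euler genus. For $A\subseteq E(G)$, the partial dual $G^{\delta(A)}$ is obtained by gluing a disc to $G$ along each boundary component of the spanning ribbon subgraph $(V(G),A)$ (these discs are the new vertices), removing the interiors of the old vertex-discs and keeping the edge ribbons; the partial Petrial $G^{\tau(A)}$ is obtained by adding a half-twist to each edge in $A$. For a word $w=w_1w_2\cdots w_n$ in $\delta,\tau$ put $G^{w(A)}=(\cdots(G^{w_n(A)})^{w_{n-1}(A)}\cdots)^{w_1(A)}$, so that the last letter is applied first. For $\bullet\in\{\delta,\tau,\delta\tau,\tau\delta,\tau\delta\tau\}$ the partial-$\bullet$ polynomial of $G$ is $${}^{\partial}\varepsilon^{\bullet}_{G}(z)=\sum_{A\subseteq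 E(G)}z^{\varepsilon(G^{\bullet(A)})}.$$ Let $M$ be a square matrix over a field with rows and columns indexed by a finite set $V$. For $A\subseteq V$ let $M[A]$ be the principal submatrix on $A$, let $A^c=V\setminus A$, let $I_A$ be the diagonal matrix with diagonal entry $1$ at the elements of $A$ and $0$ elsewhere, and let the corank of a square matrix be its order minus its rank. Put $P_{\langle\bullet\rangle}(M,z)=\sum_{A\subseteq V}z^{r_{\langle\bullet\rangle}(M,A)}$, where $$\begin{aligned} r_{\langle\delta\rangle}(M,A)&=\operatorname{rank}(M[A])+\operatorname{rank}(M[A^c]),\\ r_{\langle\tau\rangle}(M,A)&=\operatorname{rank}(M+I_A),\\ r_{\langle\delta\tau\rangle}(M,A)&=\operatorname{rank}((M+I_A)[A])+\operatorname{rank}(M[A^c]),\\ r_{\langle\tau\delta\rangle}(M,A)&=\operatorname{rank}(M+I_A)-\operatorname{corank}(M[A]),\\ r_{\langle\tau\delta\tau\rangle}(M,A)&=\operatorname{rank}(M)-\operatorname{corank}((M+I_A)[A]). \end{aligned}$$ A bouquet is a ribbon graph $B$ with exactly one vertex. Its intersection graph $I(B)$ is the simple graph with vertex set $E(B)$ in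 which two distinct loops are adjacent if and only if their ends are met in alternating order when travelling along the boundary of the vertex. Let $L_{I(B)}\subseteq E(B)$ be the set of non-orientable loops, i.e. of the loops whose union with the vertex-disc is a Möbius band. The adjacency matrix $\mathbf A_{(I(B),L_{I(B)})}$ of the intersection graft $(I(B),L_{I(B)})$ is the $E(B)\times E(B)$ matrix over $\mathrm{GF}(2)$ whose $(u,w)$ entry is $1$ if $u\ne w$ are adjacent in $I(B)$ or if $u=w\in L_{I(B)}$, and $0$ otherwise. **Theorem.** For every bouquet $B$ and every $\bullet\in\{\delta,\tau,\delta\tau,\tau\delta,\tau\delta\tau\}$, $${}^{\partial}\varepsilon^{\bullet}_{B}(z)=P_{\langle\bullet\rangle}\bigl(\mathbf A_{(I(B),L_{I(B)})},z\bigr).$$ -/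

import Mathlib

open scoped BigOperators

universe u v

/-- A finite ribbon graph with edge set `E` (a union of vertex-discs and edge-discs, meeting in
disjoint line segments, every edge containing exactly two of them), recorded up to homeomorphism
by its corners.  A *corner* is an endpoint of one of the line segments in which vertices and edges
intersect; `C` is the set of corners.  Every corner `x` lies at the end of exactly three arcs of
the boundaries of the discs:

* the line segment common to a vertex and an edge; its other endpoint is `seg x`;
* the arc of the boundary of the edge-disc that runs along the *side* of the ribbon, between its
  two line segments; its other endpoint is `side x`;
* the arc of the boundary of the vertex-disc between two cyclically consecutive line segments
  (the same segment if there is only one); its other endpoint is `arc x`.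

The boundary of an edge-disc passes through exactly four corners `x`, `seg x`, `side (seg x)`,
`side x`, in this cyclic order.  The boundary circles of the vertex-discs that meet an edge are the
closed curves made of segments and vertex arcs, and there are `isolated` further vertex-discs,
which meet no edge. -/
structure RibbonGraph (C : Type u) (E : Type v) where
  edge : C → E
  seg : C → C
  side : C → C
  arc : C → C
  isolated : ℕ
  seg_seg : ∀ x, seg (seg x) = x
  side_side : ∀ x, side (side x) = x
  arc_arc : ∀ x, arc (arc x) = x
  seg_ne : ∀ x, seg x ≠ x
  side_ne : ∀ x, side x ≠ x
  arc_ne : ∀ x, arc x ≠ x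
  seg_ne_side : ∀ x, seg x ≠ side x
  seg_side : ∀ x, seg (side x) = side (seg x)
  edge_surjective : Function.Surjective edge
  edge_eq_iff : ∀ x y, edge x = edge y ↔ y = x ∨ y = seg x ∨ y = side x ∨ y = seg (side x)

namespace RibbonGraph

variable {C : Type u} {E : Type v}

/-- The vertices: closed curves made of segments and vertex arcs, and the isolated vertices. -/
abbrev Vertex (G : RibbonGraph C E) : Type u :=
  Quot (fun x y : C => y = G.seg x ∨ y = G.arc x) ⊕ Fin G.isolated

/-- The boundary components: closed curves made of sides of ribbons and vertex arcs, and the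
boundary circles of the isolated vertices. -/
abbrev BoundaryComponent (G : RibbonGraph C E) : Type u :=
  Quot (fun x y : C => y = G.side x ∨ y = G.arc x) ⊕ Fin G.isolated

/-- The connected components. -/
abbrev Component (G : RibbonGraph C E) : Type u :=
  Quot (fun x y : C => y = G.seg x ∨ y = G.side x ∨ y = G.arc x) ⊕ Fin G.isolated

/-- `χ(G) = v(G) - e(G) + f(G)`. -/
noncomputable def eulerChar (G : RibbonGraph C E) : ℤ :=
  (Nat.card G.Vertex : ℤ) - Nat.card E + Nat.card G.BoundaryComponent

/-- The Euler genus `ε(G) = 2 c(G) - χ(G)`. -/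
noncomputable def eulerGenus (G : RibbonGraph C E) : ℤ :=
  2 * (Nat.card G.Component : ℤ) - G.eulerChar

/-- A bouquet is a ribbon graph with exactly one vertex. -/
def IsBouquet (G : RibbonGraph C E) : Prop := Nat.card G.Vertex = 1

theorem edge_seg (G : RibbonGraph C E) (x : C) : G.edge (G.seg x) = G.edge x :=
  ((G.edge_eq_iff x _).2 (Or.inr (Or.inl rfl))).symm

theorem edge_side (G : RibbonGraph C E) (x : C) : G.edge (G.side x) = G.edge x :=
  ((G.edge_eq_iff x _).2 (Or.inr (Or.inr (Or.inl rfl)))).symm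

theorem seg_side_ne (G : RibbonGraph C E) (x : C) : G.seg (G.side x) ≠ x := by
  intro h
  apply G.seg_ne_side x
  have h2 := congrArg G.seg h
  rw [G.seg_seg] at h2
  exact h2.symm

section Operations

variable [DecidableEq E]

/-- The partial dual `G^{δ(A)}`.  A boundary component of the spanning ribbon subgraph `(V(G), A)`
follows the vertex arcs, the sides of the ribbons in `A`, and the segments at which the (deleted)
ribbons outside `A` were attached.  These closed curves bound the new vertex-discs, the edge
ribbons are unchanged: so a ribbon in `A` is now attached along its former sides, its former
segments becoming its sides, and a ribbon outside `A` is attached as before. -/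
def partialDual (G : RibbonGraph C E) (A : Finset E) : RibbonGraph C E where
  edge := G.edge
  seg := fun x => if G.edge x ∈ A then G.side x else G.seg x
  side := fun x => if G.edge x ∈ A then G.seg x else G.side x
  arc := G.arc
  isolated := G.isolated
  seg_seg := by
    intro x
    by_cases h : G.edge x ∈ A <;> simp [h, edge_seg, edge_side, G.seg_seg, G.side_side]
  side_side := by
    intro x
    by_cases h : G.edge x ∈ A <;> simp [h, edge_seg, edge_side, G.seg_seg, G.side_side]
  arc_arc := G.arc_arc
  seg_ne := by
    intro x
    by_cases h : G.edge x ∈ A <;> simp [h, G.seg_ne, G.side_ne]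
  side_ne := by
    intro x
    by_cases h : G.edge x ∈ A <;> simp [h, G.seg_ne, G.side_ne]
  arc_ne := G.arc_ne
  seg_ne_side := by
    intro x
    by_cases h : G.edge x ∈ A
    · simpa [h] using (G.seg_ne_side x).symm
    · simpa [h] using G.seg_ne_side x
  seg_side := by
    intro x
    by_cases h : G.edge x ∈ A <;> simp [h, edge_seg, edge_side, G.seg_side]
  edge_surjective := G.edge_surjective
  edge_eq_iff := by
    intro x y
    rw [G.edge_eq_iff]
    by_cases h : G.edge x ∈ A
    · simp only [h, edge_seg, if_true, G.seg_side]
      tauto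
    · simp only [h, edge_side, if_false]

/-- The partial Petrial `G^{τ(A)}`: a half-twist is added to each edge in `A`, so that a side
starting at a corner `x` of such an edge now ends at the other corner of the opposite segment. -/
def partialPetrial (G : RibbonGraph C E) (A : Finset E) : RibbonGraph C E where
  edge := G.edge
  seg := G.seg
  side := fun x => if G.edge x ∈ A then G.seg (G.side x) else G.side x
  arc := G.arc
  isolated := G.isolated
  seg_seg := G.seg_seg
  side_side := by
    intro x
    by_cases h : G.edge x ∈ A
    · simp [h, edge_seg, edge_side, G.seg_side, G.seg_seg, G.side_side]
    · simp [h, edge_side, G.side_side]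
  arc_arc := G.arc_arc
  seg_ne := G.seg_ne
  side_ne := by
    intro x
    by_cases h : G.edge x ∈ A <;> simp [h, G.seg_side_ne, G.side_ne]
  arc_ne := G.arc_ne
  seg_ne_side := by
    intro x
    by_cases h : G.edge x ∈ A
    · simp only [h, if_true]
      intro h2
      apply G.side_ne x
      have h3 := congrArg G.seg h2
      rw [G.seg_seg, G.seg_seg] at h3
      exact h3.symm
    · simpa [h] using G.seg_ne_side x
  seg_side := by
    intro x
    by_cases h : G.edge x ∈ A <;> simp [h, edge_seg, G.seg_side]
  edge_surjective := G.edge_surjective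
  edge_eq_iff := by
    intro x y
    rw [G.edge_eq_iff]
    by_cases h : G.edge x ∈ A
    · simp only [h, if_true, G.seg_seg]
      tauto
    · simp only [h, if_false]

end Operations

end RibbonGraph

/-- The two letters `δ` and `τ` of operator words. -/
inductive TwualityLetter
  | delta
  | tau

/-- The five twuality operators `δ, τ, δτ, τδ, τδτ`. -/
inductive Twuality
  | delta
  | tau
  | deltaTau
  | tauDelta
  | tauDeltaTau

/-- The operator word of a twuality operator. -/
def Twuality.word : Twuality → List TwualityLetter
  | .delta => [.delta]
  | .tau => [.tau]
  | .deltaTau => [.delta, .tau]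
  | .tauDelta => [.tau, .delta]
  | .tauDeltaTau => [.tau, .delta, .tau]

namespace RibbonGraph

variable {C : Type u} {E : Type v}

section Twuality

variable [DecidableEq E]

/-- The partial dual `G^{δ(A)}` or the partial Petrial `G^{τ(A)}`. -/
def applyLetter (G : RibbonGraph C E) (A : Finset E) : TwualityLetter → RibbonGraph C E
  | .delta => G.partialDual A
  | .tau => G.partialPetrial A

/-- `G^{w(A)}` for a word `w = w₁ w₂ ⋯ wₙ`: the last letter `wₙ` is applied first and the first
letter `w₁` is applied last. -/
def applyWord (G : RibbonGraph C E) (A : Finset E) : List TwualityLetter → RibbonGraph C E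
  | [] => G
  | l :: w => (G.applyWord A w).applyLetter A l

/-- The partial-`•` polynomial `∑_{A ⊆ E(G)} z^{ε(G^{•(A)})}` of a ribbon graph, with integer
exponents, in `ℤ[z, z⁻¹]`. -/
noncomputable def partialPoly [Fintype E] (G : RibbonGraph C E) (t : Twuality) :
    LaurentPolynomial ℤ :=
  ∑ A : Finset E, LaurentPolynomial.T (G.applyWord A t.word).eulerGenus

end Twuality

/-- Travelling along the boundary of a vertex: a line segment is entered at the corner `x` and
left at the corner `seg x`; `next x` is the corner at which the following segment is entered. -/
def next (G : RibbonGraph C E) (x : C) : C := G.arc (G.seg x)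

/-- Starting with an end of `e` and making at most one turn along the boundary of the vertex, one
encounters ends of the edges `e, f, e, f` in this order. -/
def Alternate (G : RibbonGraph C E) (e f : E) : Prop :=
  ∃ (x : C) (j k l : ℕ), 0 < j ∧ j < k ∧ k < l ∧ l < Function.minimalPeriod G.next x ∧
    G.edge x = e ∧ G.edge (G.next^[j] x) = f ∧ G.edge (G.next^[k] x) = e ∧
    G.edge (G.next^[l] x) = f

/-- The intersection graph: two distinct loops are adjacent if they are interlaced, that is, if
their ends are encountered in an alternating order along the boundary of the vertex. -/
def intersectionGraph (G : RibbonGraph C E) : SimpleGraph E :=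
  SimpleGraph.fromRel G.Alternate

/-- `e` is a non-orientable loop at its vertex `v`, that is, `e ∪ v` is a Möbius band.  A direction
of travel along the boundary of `v` orients `v`; it enters an end of `e` at the corner `x`.  The
orientation of `v` extends over `e` exactly if the side of `e` that starts at `x` ends at the
corner at which the other end of `e` is *left*.  The loop is non-orientable if it ends at the
corner at which the other end of `e` is *entered*, in the same direction of travel. -/
def IsNonorientableLoop (G : RibbonGraph C E) (e : E) : Prop :=
  ∃ x : C, G.edge x = e ∧ ∃ n : ℕ, G.next^[n] x = G.side x

end RibbonGraph

/-- A graft: a simple graph together with a set of vertices. -/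
structure Graft (V : Type v) where
  graph : SimpleGraph V
  marked : Set V

open Classical in
/-- The adjacency matrix of a graft, over `GF(2)`. -/
noncomputable def Graft.adjMatrix {V : Type v} (H : Graft V) : Matrix V V (ZMod 2) :=
  Matrix.of fun u w => if (u ≠ w ∧ H.graph.Adj u w) ∨ (u = w ∧ u ∈ H.marked) then 1 else 0

/-- The intersection graft `(I(B), L_{I(B)})`, the set `L_{I(B)}` being that of the non-orientable
loops. -/
def RibbonGraph.intersectionGraft {C : Type u} {E : Type v} (B : RibbonGraph C E) : Graft E where
  graph := B.intersectionGraph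
  marked := {e | B.IsNonorientableLoop e}

namespace PartialMatrix

/-- The principal submatrix `M[A]`. -/
def principal {V : Type v} {K : Type u} (M : Matrix V V K) (A : Finset V) :
    Matrix {x // x ∈ A} {x // x ∈ A} K :=
  M.submatrix Subtype.val Subtype.val

/-- The corank of a square matrix, its order minus its rank. -/
noncomputable def corank {V : Type v} {K : Type u} [Field K] [Fintype V] (M : Matrix V V K) : ℤ :=
  (Fintype.card V : ℤ) - M.rank

/-- The diagonal matrix `I_A`, with diagonal entry `1` exactly at the elements of `A`. -/
def diagInd {V : Type v} (K : Type u) [Field K] [DecidableEq V] (A : Finset V) : Matrix V V K :=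
  Matrix.diagonal fun i => if i ∈ A then 1 else 0

/-- The exponent `r_{⟨•⟩}(M, A)`. -/
noncomputable def exponent {V : Type v} {K : Type u} [Field K] [Fintype V] [DecidableEq V]
    (t : Twuality) (M : Matrix V V K) (A : Finset V) : ℤ :=
  match t with
  | .delta => ((principal M A).rank : ℤ) + (principal M Aᶜ).rank
  | .tau => ((M + diagInd K A).rank : ℤ)
  | .deltaTau => ((principal (M + diagInd K A) A).rank : ℤ) + (principal M Aᶜ).rank
  | .tauDelta => ((M + diagInd K A).rank : ℤ) - corank (principal M A)
  | .tauDeltaTau => (M.rank : ℤ) - corank (principal (M + diagInd K A) A)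

/-- The partial-`⟨•⟩` polynomial `∑_{A ⊆ V} z^{r_{⟨•⟩}(M, A)}` of a square matrix, with integer
exponents, in `ℤ[z, z⁻¹]`. -/
noncomputable def poly {V : Type v} {K : Type u} [Field K] [Fintype V] [DecidableEq V]
    (t : Twuality) (M : Matrix V V K) : LaurentPolynomial ℤ :=
  ∑ A : Finset V, LaurentPolynomial.T (exponent t M A)

end PartialMatrix

/-- The partial-`⟨•⟩` polynomial of a graft. -/
noncomputable def Graft.partialPoly {V : Type v} [Fintype V] [DecidableEq V]
    (H : Graft V) (t : Twuality) : LaurentPolynomial ℤ :=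
  PartialMatrix.poly t H.adjMatrix

/-! Partial duals and partial Petrials keep the corners and vertex arcs; on each ribbon they only
permute the three perfect matchings of its four corners: segments, sides and diagonals. So the
vertices and the boundary components of every twual of `B` are closed curves made of vertex arcs and
one chosen matching per ribbon. The twual is connected, so its Euler genus follows from two such
curve counts.

The number of curves is the dimension of the space of GF(2)-valued functions on corners that are
constant on each curve. As `B` has a single vertex, such a function is, up to a constant, determined
by its jumps at segments. It equals `c + ∑ h_e φ_e`, where `φ_e` is a potential of `e` and `h` lives
on the set `T` of ribbons not matched along segments. Across a side of `e`, `φ_f` changes by the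
`(e, f)` entry of the adjacency matrix `M` (`IsBouquet.adjMatrix_apply`), so if `D` is the set of
ribbons matched along diagonals, invariance says `(M + I_D)[T] h = 0`. There are thus `1 + corank`
curves (`IsBouquet.card_quot_pairing`), and the Euler genus is `|E|` minus two coranks
(`IsBouquet.eulerGenus_eq`). -/

namespace RibbonGraph

variable {C : Type u} {E : Type v}

/-! ### Travelling around the vertex -/

theorem finite_corners [Finite E] (G : RibbonGraph C E) : Finite C := by
  choose x hx using G.edge_surjective
  refine Finite.of_surjective
    (fun q : E × Bool × Bool =>
      (if q.2.1 then G.seg else id) ((if q.2.2 then G.side else id) (x q.1))) fun y => ?_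
  rcases (G.edge_eq_iff (x (G.edge y)) y).1 (hx _) with h | h | h | h
  · exact ⟨(G.edge y, false, false), by simp [← h]⟩
  · exact ⟨(G.edge y, true, false), by simp [← h]⟩
  · exact ⟨(G.edge y, false, true), by simp [← h]⟩
  · exact ⟨(G.edge y, true, true), by simp [← h]⟩

theorem arc_next (G : RibbonGraph C E) (x : C) : G.arc (G.next x) = G.seg x := G.arc_arc _

theorem next_injective (G : RibbonGraph C E) : Function.Injective G.next :=
  (Function.LeftInverse.injective (g := fun x => G.seg (G.arc x)) fun x => by
    simp [next, G.arc_arc, G.seg_seg])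

theorem minimalPeriod_next_pos [Finite E] (G : RibbonGraph C E) (x : C) :
    0 < Function.minimalPeriod G.next x :=
  have := G.finite_corners
  Function.minimalPeriod_pos_of_mem_periodicPts (G.next_injective.mem_periodicPts x)

/-- Travelling along a vertex in one direction, no segment is entered at both of its corners. -/
theorem iterate_next_ne_seg (G : RibbonGraph C E) (k : ℕ) (x : C) : G.next^[k] x ≠ G.seg x := by
  induction k using Nat.strong_induction_on generalizing x with
  | _ k ih =>
    match k with
    | 0 => exact (G.seg_ne x).symm
    | 1 => exact G.arc_ne _
    | k + 2 =>
      intro h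
      -- `seg` reverses the direction of travel, so one step can be cancelled at each end of the
      -- path; the base cases say that `seg` and `arc` have no fixed points.
      apply ih k (by omega) (G.next x)
      rw [Function.iterate_succ_apply, Function.iterate_succ_apply', ← G.arc_next x] at h
      have h2 := congrArg (fun y => G.seg (G.arc y)) h
      simpa [next, G.arc_arc, G.seg_seg] using h2

theorem exists_iterate_next_eq [Finite E] (G : RibbonGraph C E) (x : C) (k : ℕ) :
    ∃ i < Function.minimalPeriod G.next x, G.next^[i] x = G.next^[k] x :=
  ⟨_, Nat.mod_lt _ (G.minimalPeriod_next_pos x), Function.iterate_mod_minimalPeriod_eq⟩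

theorem iterate_next_inj (G : RibbonGraph C E) {x : C} {i j : ℕ}
    (hi : i < Function.minimalPeriod G.next x) (hj : j < Function.minimalPeriod G.next x)
    (h : G.next^[i] x = G.next^[j] x) : i = j :=
  Function.iterate_injOn_Iio_minimalPeriod hi hj h

/-- Adding `j` full periods to `i` changes no corner and makes the exponent at least `j`, which
reduces to travel starting at `G.next^[j] x`. -/
theorem iterate_next_ne_seg_iterate [Finite E] (G : RibbonGraph C E) (x : C) (i j : ℕ) :
    G.next^[i] x ≠ G.seg (G.next^[j] x) := by
  intro h
  have hn := G.minimalPeriod_next_pos x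
  set n := Function.minimalPeriod G.next x with hn'
  have h1 : G.next^[i + n * j] x = G.next^[i] x := by
    rw [Function.iterate_add_apply]
    congr 1
    exact ((Function.isPeriodicPt_minimalPeriod G.next x).mul_const j)
  have hj : j ≤ i + n * j := by nlinarith
  apply G.iterate_next_ne_seg (i + n * j - j) (G.next^[j] x)
  rw [← Function.iterate_add_apply, Nat.sub_add_cancel hj, h1, h]

/-- A function on the corners that is constant along segments and vertex arcs is constant on a
bouquet. -/
theorem IsBouquet.eq_of_invariant {G : RibbonGraph C E} (hG : G.IsBouquet) {α : Type*} (f : C → α)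
    (hseg : ∀ x, f (G.seg x) = f x) (harc : ∀ x, f (G.arc x) = f x) (x y : C) : f x = f y := by
  have := (Nat.card_eq_one_iff_unique.1 hG).1
  have h : (Sum.inl (Quot.mk _ x) : G.Vertex) = Sum.inl (Quot.mk _ y) := Subsingleton.elim _ _
  have h2 := Sum.inl.inj h
  have := congrArg (Quot.lift f (by
    rintro a b (rfl | rfl)
    · exact (hseg a).symm
    · exact (harc a).symm)) h2
  exact this

/-- The corners met when travelling from `x` are closed under `seg` and `arc`, hence are all corners
of a bouquet. -/
theorem IsBouquet.exists_iterate_next [Finite E] {G : RibbonGraph C E} (hG : G.IsBouquet)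
    (x y : C) : ∃ k < Function.minimalPeriod G.next x,
      y = G.next^[k] x ∨ y = G.seg (G.next^[k] x) := by
  have key : ∃ k, y = G.next^[k] x ∨ y = G.seg (G.next^[k] x) := by
    have step1 : ∀ y, (∃ k, y = G.next^[k] x ∨ y = G.seg (G.next^[k] x)) →
        ∃ k, G.seg y = G.next^[k] x ∨ G.seg y = G.seg (G.next^[k] x) := by
      rintro y ⟨k, rfl | rfl⟩
      · exact ⟨k, Or.inr rfl⟩
      · exact ⟨k, Or.inl (G.seg_seg _)⟩
    have step2 : ∀ y, (∃ k, y = G.next^[k] x ∨ y = G.seg (G.next^[k] x)) →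
        ∃ k, G.arc y = G.next^[k] x ∨ G.arc y = G.seg (G.next^[k] x) := by
      rintro y ⟨k, rfl | rfl⟩
      · obtain ⟨m, hm⟩ : ∃ m, G.next^[m + 1] x = G.next^[k] x := by
          -- An arc taken at an entered corner leads one step back; adding a period covers `k = 0`.
          refine ⟨k + Function.minimalPeriod G.next x - 1, ?_⟩
          have := G.minimalPeriod_next_pos x
          rw [show k + Function.minimalPeriod G.next x - 1 + 1
            = k + Function.minimalPeriod G.next x by omega, Function.iterate_add_apply,
            Function.iterate_minimalPeriod]
        refine ⟨m, Or.inr ?_⟩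
        rw [← hm, Function.iterate_succ_apply', arc_next]
      · exact ⟨k + 1, Or.inl (by rw [Function.iterate_succ_apply']; rfl)⟩
    have h := hG.eq_of_invariant (fun y => ∃ k, y = G.next^[k] x ∨ y = G.seg (G.next^[k] x))
      (fun y => propext ⟨fun h => by simpa [G.seg_seg] using step1 _ h, step1 y⟩)
      (fun y => propext ⟨fun h => by simpa [G.arc_arc] using step2 _ h, step2 y⟩) x y
    exact h.mp ⟨0, Or.inl rfl⟩
  obtain ⟨k, hk⟩ := key
  obtain ⟨i, hi, h⟩ := G.exists_iterate_next_eq x k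
  exact ⟨i, hi, by rwa [h]⟩

/-- Travelling along the vertex of a bouquet, starting with an end of an edge, one meets exactly one
further end of that edge. -/
theorem IsBouquet.exists_second_end [Finite E] {G : RibbonGraph C E} (hG : G.IsBouquet) (x : C) :
    ∃ k, 0 < k ∧ k < Function.minimalPeriod G.next x ∧
      (G.next^[k] x = G.side x ∨ G.next^[k] x = G.seg (G.side x)) ∧
      ∀ i < Function.minimalPeriod G.next x,
        (G.edge (G.next^[i] x) = G.edge x ↔ i = 0 ∨ i = k) := by
  obtain ⟨k, hk, h⟩ := hG.exists_iterate_next x (G.side x)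
  have h' : G.next^[k] x = G.side x ∨ G.next^[k] x = G.seg (G.side x) :=
    h.imp Eq.symm fun h => by rw [h, G.seg_seg]
  refine ⟨k, ?_, hk, h', fun i hi => ⟨fun he => ?_, ?_⟩⟩
  · rcases Nat.eq_zero_or_pos k with rfl | h0
    · rcases h' with h' | h'
      · exact absurd h'.symm (G.side_ne x)
      · exact absurd h'.symm (G.seg_side_ne x)
    · exact h0
  · have hs := G.iterate_next_ne_seg_iterate x i k
    -- Of the four corners of the edge, two are entered, at times `0` and `k`; the other two are
    -- their `seg` partners, which are never entered.
    rcases (G.edge_eq_iff x _).1 he.symm with h1 | h1 | h1 | h1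
    · exact Or.inl (G.iterate_next_inj hi (G.minimalPeriod_next_pos x) h1)
    · exact absurd h1 (G.iterate_next_ne_seg i x)
    · rcases h' with h' | h'
      · exact Or.inr (G.iterate_next_inj hi hk (h1.trans h'.symm))
      · exact absurd (by rw [h1, h', G.seg_seg]) hs
    · rcases h' with h' | h'
      · exact absurd (by rw [h1, h']) hs
      · exact Or.inr (G.iterate_next_inj hi hk (h1.trans h'.symm))
  · rintro (rfl | rfl)
    · rfl
    · rcases h' with h' | h' <;> simp [h', edge_seg, edge_side]

/-! ### Potentials of edges -/

/-- A potential of the edge `e`: a function on the corners that is constant along the vertex arcs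
and jumps exactly at the segments of `e`. -/
structure IsPotential [DecidableEq E] (G : RibbonGraph C E) (e : E) (φ : C → ZMod 2) : Prop where
  arc : ∀ x, φ (G.arc x) = φ x
  seg : ∀ x, φ (G.seg x) = φ x + if G.edge x = e then 1 else 0

theorem IsBouquet.exists_isPotential [Finite E] [DecidableEq E] {G : RibbonGraph C E}
    (hG : G.IsBouquet) (e : E) : ∃ φ, G.IsPotential e φ := by
  classical
  obtain ⟨x, rfl⟩ := G.edge_surjective e
  obtain ⟨k, h0, hk, -, he⟩ := hG.exists_second_end x
  set n := Function.minimalPeriod G.next x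
  -- The two ends of the edge cut the vertex boundary in two; `S` is the part from leaving the first
  -- end, at `seg x`, to entering the second. Its indicator is the potential.
  let S : C → Prop := fun y => ∃ i < k, y = G.next^[i + 1] x ∨ y = G.seg (G.next^[i] x)
  have hS : ∀ m < n, S (G.next^[m] x) ↔ 0 < m ∧ m ≤ k := by
    intro m hm
    constructor
    · rintro ⟨i, hi, h | h⟩
      · have := G.iterate_next_inj hm (by omega) h
        omega
      · exact absurd h (G.iterate_next_ne_seg_iterate x _ _)
    · rintro ⟨h1, h2⟩
      exact ⟨m - 1, by omega, Or.inl (by rw [Nat.sub_add_cancel h1])⟩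
  have hS' : ∀ m < n, S (G.seg (G.next^[m] x)) ↔ m < k := by
    intro m hm
    constructor
    · rintro ⟨i, hi, h | h⟩
      · exact absurd h.symm (G.iterate_next_ne_seg_iterate x _ _)
      · have h2 := congrArg G.seg h
        rw [G.seg_seg, G.seg_seg] at h2
        have := G.iterate_next_inj hm (by omega) h2
        omega
    · exact fun h => ⟨m, h, Or.inr rfl⟩
  have hSarc : ∀ y, S y → S (G.arc y) := by
    rintro y ⟨i, hi, rfl | rfl⟩
    · exact ⟨i, hi, Or.inr (by rw [Function.iterate_succ_apply', arc_next])⟩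
    · exact ⟨i, hi, Or.inl (by rw [Function.iterate_succ_apply']; rfl)⟩
  have hφ : ∀ m < n, (if S (G.seg (G.next^[m] x)) then (1 : ZMod 2) else 0)
      = (if S (G.next^[m] x) then 1 else 0) +
        if G.edge (G.next^[m] x) = G.edge x then 1 else 0 := by
    intro m hm
    simp only [hS m hm, hS' m hm, he m hm]
    have h11 : (0 : ZMod 2) = 1 + 1 := by decide
    rcases lt_trichotomy m k with h | h | h
    · rcases Nat.eq_zero_or_pos m with rfl | hm0
      · simp [h0]
      · simp [h, h.le, hm0, hm0.ne', h.ne]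
    · simp [h, h0, ← h11]
    · simp [h.not_gt, h.not_ge, h.ne', (h0.trans h).ne']
  refine ⟨fun y => if S y then 1 else 0, fun y => ?_, fun y => ?_⟩
  · have : S (G.arc y) ↔ S y := ⟨fun h => by simpa [G.arc_arc] using hSarc _ h, hSarc y⟩
    simp only [this]
  · obtain ⟨m, hm, rfl | rfl⟩ := hG.exists_iterate_next x y
    · exact hφ m hm
    · have := hφ m hm
      rw [G.seg_seg, edge_seg, this, add_assoc, CharTwo.add_self_eq_zero, add_zero]

theorem IsPotential.iterate_next [DecidableEq E] {G : RibbonGraph C E} {e : E} {φ : C → ZMod 2}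
    (h : G.IsPotential e φ) (x : C) (k : ℕ) :
    φ (G.next^[k] x) = φ x +
      ∑ i ∈ Finset.range k, if G.edge (G.next^[i] x) = e then 1 else 0 := by
  induction k with
  | zero => simp
  | succ k ih =>
    rw [Function.iterate_succ_apply', next, h.arc, h.seg, ih, Finset.sum_range_succ, add_assoc]

end RibbonGraph

/-! ### Interlacement and orientability read off from potentials -/

namespace RibbonGraph

variable {C : Type u} {E : Type v} {G : RibbonGraph C E}

theorem minimalPeriod_next_iterate [Finite E] (G : RibbonGraph C E) (x : C) (k : ℕ) :
    Function.minimalPeriod G.next (G.next^[k] x) = Function.minimalPeriod G.next x :=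
  have := G.finite_corners
  Function.minimalPeriod_apply_iterate (G.next_injective.mem_periodicPts x) k

/-- Restarting at the first of the three ends, `exists_second_end` leaves only one offset for the
other two. -/
theorem IsBouquet.not_three_ends [Finite E] (hG : G.IsBouquet) {x : C} {i j k : ℕ}
    (hij : i < j) (hjk : j < k) (hk : k < Function.minimalPeriod G.next x)
    (h1 : G.edge (G.next^[j] x) = G.edge (G.next^[i] x))
    (h2 : G.edge (G.next^[k] x) = G.edge (G.next^[i] x)) : False := by
  obtain ⟨m, -, -, -, h⟩ := hG.exists_second_end (G.next^[i] x)
  rw [minimalPeriod_next_iterate] at h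
  have a := (h (j - i) (by omega)).1
    (by rw [← Function.iterate_add_apply, Nat.sub_add_cancel hij.le, h1])
  have b := (h (k - i) (by omega)).1
    (by rw [← Function.iterate_add_apply, Nat.sub_add_cancel (hij.trans hjk).le, h2])
  omega

theorem IsBouquet.eq_of_edge_eq [Finite E] (hG : G.IsBouquet) {x : C} {i j k : ℕ} {e : E}
    (hij : i < j) (hj : j < Function.minimalPeriod G.next x)
    (hk : k < Function.minimalPeriod G.next x) (h1 : G.edge (G.next^[i] x) = e)
    (h2 : G.edge (G.next^[j] x) = e) (h3 : G.edge (G.next^[k] x) = e) : k = i ∨ k = j := by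
  by_contra! h
  rcases lt_or_gt_of_ne h.1 with hki | hki
  · exact hG.not_three_ends hki hij hj (h1.trans h3.symm) (h2.trans h3.symm)
  · rcases lt_or_gt_of_ne h.2 with hkj | hkj
    · exact hG.not_three_ends hki hkj hj (h3.trans h1.symm) (h2.trans h1.symm)
    · exact hG.not_three_ends hij hkj hk (h2.trans h1.symm) (h3.trans h1.symm)

theorem IsPotential.add_side_seg [DecidableEq E] {f : E} {φ : C → ZMod 2} (h : G.IsPotential f φ) (x : C) :
    φ (G.seg x) + φ (G.side (G.seg x)) = φ x + φ (G.side x) := by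
  rw [← G.seg_side, h.seg, h.seg, edge_side, add_add_add_comm, CharTwo.add_self_eq_zero, add_zero]

/-- The change of a potential across a ribbon depends only on the edge. -/
theorem IsPotential.add_side_eq [DecidableEq E] {f : E} {φ : C → ZMod 2} (h : G.IsPotential f φ) {x y : C}
    (hxy : G.edge x = G.edge y) : φ y + φ (G.side y) = φ x + φ (G.side x) := by
  rcases (G.edge_eq_iff x y).1 hxy with rfl | rfl | rfl | rfl
  · rfl
  · exact h.add_side_seg x
  · rw [G.side_side, add_comm]
  · rw [h.add_side_seg, G.side_side, add_comm]

theorem IsBouquet.eq_side_or [Finite E] (hG : G.IsBouquet) {x : C} {k : ℕ} (h0 : 0 < k)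
    (hk : k < Function.minimalPeriod G.next x) (h : G.edge (G.next^[k] x) = G.edge x) :
    G.next^[k] x = G.side x ∨ G.next^[k] x = G.seg (G.side x) := by
  obtain ⟨m, -, -, h1, h2⟩ := hG.exists_second_end x
  obtain rfl : k = m := by have := (h2 k hk).1 h; omega
  exact h1

/-- For an edge other than `f`, `φ` does not jump at its segments, so it is irrelevant whether the
second end is entered at `side x` or at `seg (side x)`: the change is the parity of the ends of `f`
passed on the way. -/
theorem IsBouquet.add_side_of_ne [Finite E] [DecidableEq E] (hG : G.IsBouquet) {f : E} {φ : C → ZMod 2}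
    (hφ : G.IsPotential f φ) {x : C} (hne : G.edge x ≠ f) {k : ℕ} (h0 : 0 < k)
    (hk : k < Function.minimalPeriod G.next x) (h : G.edge (G.next^[k] x) = G.edge x) :
    φ x + φ (G.side x) =
      ∑ i ∈ Finset.range k, if G.edge (G.next^[i] x) = f then 1 else 0 := by
  have h1 : φ (G.next^[k] x) = φ (G.side x) := by
    rcases hG.eq_side_or h0 hk h with h | h
    · rw [h]
    · rw [h, hφ.seg, edge_side, if_neg hne, add_zero]
  rw [← h1, hφ.iterate_next, ← add_assoc, CharTwo.add_self_eq_zero, zero_add]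

theorem IsBouquet.add_side_eq_one [Finite E] [DecidableEq E] (hG : G.IsBouquet) {f : E} {φ : C → ZMod 2}
    (hφ : G.IsPotential f φ) {x : C} (hne : G.edge x ≠ f) {j k : ℕ} (hjk : j < k)
    (hk : k < Function.minimalPeriod G.next x) (h : G.edge (G.next^[k] x) = G.edge x)
    (hj : G.edge (G.next^[j] x) = f) (hu : ∀ i < k, G.edge (G.next^[i] x) = f → i = j) :
    φ x + φ (G.side x) = 1 := by
  rw [hG.add_side_of_ne hφ hne (by omega) hk h, Finset.sum_eq_single j]
  · rw [if_pos hj]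
  · exact fun i hi hij => if_neg fun h => hij (hu i (Finset.mem_range.1 hi) h)
  · exact fun h => absurd (Finset.mem_range.2 hjk) h

theorem IsBouquet.add_side_of_alternate [Finite E] [DecidableEq E] (hG : G.IsBouquet) {f : E} {φ : C → ZMod 2}
    (hφ : G.IsPotential f φ) {x : C} (hne : G.edge x ≠ f)
    (ha : G.Alternate (G.edge x) f) : φ x + φ (G.side x) = 1 := by
  obtain ⟨y, j, k, l, h0, hjk, hkl, hl, hy, hj, hk, hl'⟩ := ha
  rw [hφ.add_side_eq hy]
  refine hG.add_side_eq_one hφ (hy ▸ hne) hjk (by omega) (hk.trans hy.symm) hj fun i hi h => ?_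
  have := hG.eq_of_edge_eq (hjk.trans hkl) hl (by omega) hj hl' h
  omega

/-- Needed because `SimpleGraph.fromRel` symmetrizes `Alternate`, whose pattern may start with `f`.
Restarting at time `j`, exactly one end of `f` lies before the second end of the other edge. -/
theorem IsBouquet.add_side_of_alternate' [Finite E] [DecidableEq E] (hG : G.IsBouquet) {f : E} {φ : C → ZMod 2}
    (hφ : G.IsPotential f φ) {x : C} (hne : G.edge x ≠ f)
    (ha : G.Alternate f (G.edge x)) : φ x + φ (G.side x) = 1 := by
  obtain ⟨y, j, k, l, h0, hjk, hkl, hl, hy, hj, hk, hl'⟩ := ha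
  rw [hφ.add_side_eq hj]
  have e1 : ∀ i, G.next^[i] (G.next^[j] y) = G.next^[i + j] y := fun i =>
    (Function.iterate_add_apply _ _ _ _).symm
  refine hG.add_side_eq_one hφ (hj ▸ hne) (j := k - j) (k := l - j) (by omega)
    (by rw [minimalPeriod_next_iterate]; omega) ?_ ?_ fun i hi h => ?_
  · rw [e1, Nat.sub_add_cancel (by omega), hl', hj]
  · rw [e1, Nat.sub_add_cancel (by omega), hk]
  · rw [e1] at h
    have := hG.eq_of_edge_eq (h0.trans hjk) (by omega) (by omega) hy hk h
    omega

/-- An odd number of ends of `f` lies between the two ends of the edge. If both did, they would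
cancel mod 2, so the second one comes after time `k`. -/
theorem IsBouquet.alternate_of_add_side [Finite E] [DecidableEq E] (hG : G.IsBouquet) {f : E} {φ : C → ZMod 2}
    (hφ : G.IsPotential f φ) {x : C} (hne : G.edge x ≠ f)
    (h : φ x + φ (G.side x) ≠ 0) : G.Alternate (G.edge x) f := by
  obtain ⟨k, h0, hk, -, hend⟩ := hG.exists_second_end x
  have hke := (hend k hk).2 (Or.inr rfl)
  rw [hG.add_side_of_ne hφ hne h0 hk hke] at h
  obtain ⟨j, hj, hjf⟩ := Finset.exists_ne_zero_of_sum_ne_zero h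
  have hjf' : G.edge (G.next^[j] x) = f := by
    by_contra h
    exact hjf (if_neg h)
  rw [Finset.mem_range] at hj
  have hj0 : 0 < j := Nat.pos_of_ne_zero (by rintro rfl; exact hne hjf')
  obtain ⟨l, hl, hlj, hlf⟩ : ∃ l < Function.minimalPeriod G.next x, l ≠ j ∧
      G.edge (G.next^[l] x) = f := by
    obtain ⟨m, hm0, hm, -, hm'⟩ := hG.exists_second_end (G.next^[j] x)
    have hmf := (hm' m hm).2 (Or.inr rfl)
    rw [minimalPeriod_next_iterate] at hm
    rw [← Function.iterate_add_apply, hjf'] at hmf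
    obtain ⟨l, hl, h⟩ := G.exists_iterate_next_eq x (m + j)
    refine ⟨l, hl, ?_, by rw [h, hmf]⟩
    rintro rfl
    rw [add_comm, Function.iterate_add_apply] at h
    have h3 := (G.next_injective.iterate _) h
    have := G.iterate_next_inj (x := x) (i := 0) (j := m) (by omega) hm h3
    omega
  have hkl : k < l := by
    by_contra hlk
    have hlk' : l < k := by
      refine lt_of_le_of_ne (not_lt.1 hlk) ?_
      rintro rfl
      exact hne (hke.symm.trans hlf)
    apply h
    rw [← Finset.sum_subset (s₁ := {j, l})]
    · rw [Finset.sum_pair hlj.symm, if_pos hjf', if_pos hlf, CharTwo.add_self_eq_zero]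
    · intro i
      simp only [Finset.mem_insert, Finset.mem_singleton, Finset.mem_range]
      omega
    · intro i hi hi2
      refine if_neg fun hif => hi2 ?_
      rw [Finset.mem_range] at hi
      simp only [Finset.mem_insert, Finset.mem_singleton]
      rcases lt_or_gt_of_ne hlj with h' | h'
      · exact (hG.eq_of_edge_eq h' (by omega) (by omega) hlf hjf' hif).symm
      · exact hG.eq_of_edge_eq h' (by omega) (by omega) hjf' hlf hif
  exact ⟨x, j, k, l, hj0, hj, hkl, hl, rfl, hjf', hke, hlf⟩

/-- Between its two ends the loop contributes one jump, so the second end is entered at value `φ x +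
1` and left at value `φ x`. Hence the sum is `1` exactly when `side x` is the corner of entry. -/
theorem IsBouquet.add_side_self [Finite E] [DecidableEq E] (hG : G.IsBouquet) {φ : C → ZMod 2} {x : C}
    (hφ : G.IsPotential (G.edge x) φ) :
    φ x + φ (G.side x) = 1 ↔ G.IsNonorientableLoop (G.edge x) := by
  have key : ∀ y, G.edge y = G.edge x → ∀ k, 0 < k → k < Function.minimalPeriod G.next y →
      G.edge (G.next^[k] y) = G.edge y → φ (G.next^[k] y) = φ y + 1 := by
    intro y hy k h0 hk h
    rw [hφ.iterate_next, Finset.sum_eq_single 0]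
    · rw [Function.iterate_zero_apply, if_pos hy]
    · intro i hi hi0
      rw [Finset.mem_range] at hi
      refine if_neg fun h' => ?_
      have := hG.eq_of_edge_eq h0 hk (by omega) hy (h.trans hy) h'
      omega
    · exact fun h => absurd (Finset.mem_range.2 h0) h
  constructor
  · intro h
    obtain ⟨k, h0, hk, h1, h2⟩ := hG.exists_second_end x
    have hk' := key x rfl k h0 hk ((h2 k hk).2 (Or.inr rfl))
    rcases h1 with h1 | h1
    · exact ⟨x, rfl, k, h1⟩
    · rw [h1, hφ.seg, edge_side, if_pos rfl] at hk'
      rw [add_right_cancel hk', CharTwo.add_self_eq_zero] at h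
      exact absurd h zero_ne_one
  · rintro ⟨y, hy, n, hn⟩
    obtain ⟨k, hk, hkn⟩ := G.exists_iterate_next_eq y n
    rw [hn] at hkn
    have h0 : 0 < k := Nat.pos_of_ne_zero (by rintro rfl; exact G.side_ne y hkn.symm)
    have := key y hy k h0 hk (by rw [hkn, edge_side])
    rw [hφ.add_side_eq hy, ← hkn, this, ← add_assoc, CharTwo.add_self_eq_zero, zero_add]

/-- The adjacency matrix of the intersection graft records the changes of the potentials across the
ribbons. -/
theorem IsBouquet.adjMatrix_apply [Finite E] [DecidableEq E] (hG : G.IsBouquet) {f : E} {φ : C → ZMod 2}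
    (hφ : G.IsPotential f φ) (x : C) :
    G.intersectionGraft.adjMatrix (G.edge x) f = φ x + φ (G.side x) := by
  have h01 : ∀ a : ZMod 2, a ≠ 1 → 0 = a := by decide
  rw [Graft.adjMatrix, Matrix.of_apply]
  split
  · rename_i h
    rcases h with ⟨hne, h⟩ | ⟨rfl, h⟩
    · rcases ((SimpleGraph.fromRel_adj _ _ _).1 h).2 with h | h
      · exact (hG.add_side_of_alternate hφ hne h).symm
      · exact (hG.add_side_of_alternate' hφ hne h).symm
    · exact ((hG.add_side_self hφ).2 h).symm
  · rename_i h
    refine h01 _ fun h1 => h ?_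
    by_cases he : G.edge x = f
    · subst he
      exact Or.inr ⟨rfl, (hG.add_side_self hφ).1 h1⟩
    · refine Or.inl ⟨he, (SimpleGraph.fromRel_adj _ _ _).2 ⟨he, Or.inl ?_⟩⟩
      exact hG.alternate_of_add_side hφ he (by rw [h1]; exact one_ne_zero)

end RibbonGraph

/-! ### Counting closed curves by linear algebra over GF(2) -/

namespace RibbonGraph

variable {C : Type u} {E : Type v} {G : RibbonGraph C E}

/-- The pairing of the corners that joins the ends of the segments of the ribbons outside `T`, of
the sides of the ribbons in `T \ D`, and of the diagonals of the ribbons in `T ∩ D`. -/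
def pairing [DecidableEq E] (G : RibbonGraph C E) (T D : Finset E) (x : C) : C :=
  if G.edge x ∈ T then if G.edge x ∈ D then G.seg (G.side x) else G.side x else G.seg x

/-- The functions on the corners that are constant along vertex arcs and on the pairs of `p`. -/
def invariants (G : RibbonGraph C E) (p : C → C) : Submodule (ZMod 2) (C → ZMod 2) where
  carrier := {f | ∀ x, f (G.arc x) = f x ∧ f (p x) = f x}
  add_mem' := fun ha hb x => by simp [(ha x).1, (ha x).2, (hb x).1, (hb x).2]
  zero_mem' := fun _ => ⟨rfl, rfl⟩
  smul_mem' := fun c f hf x => by simp [(hf x).1, (hf x).2]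

/-- Invariant functions are exactly the functions on the set of curves. -/
theorem finrank_invariants [Finite C] (G : RibbonGraph C E) (p : C → C) :
    Module.finrank (ZMod 2) (G.invariants p) =
      Nat.card (Quot fun x y : C => y = p x ∨ y = G.arc x) := by
  let e : (Quot (fun x y : C => y = p x ∨ y = G.arc x) → ZMod 2) ≃ₗ[ZMod 2] G.invariants p :=
    { toFun := fun f => ⟨fun x => f (Quot.mk _ x), fun x =>
        ⟨congrArg f (Eq.symm (Quot.sound (Or.inr rfl))),
          congrArg f (Eq.symm (Quot.sound (Or.inl rfl)))⟩⟩
      map_add' := fun _ _ => rfl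
      map_smul' := fun _ _ => rfl
      invFun := fun f => Quot.lift f.1 (by
        rintro a b (rfl | rfl)
        · exact (f.2 a).2.symm
        · exact (f.2 a).1.symm)
      left_inv := fun f => by
        ext q
        induction q using Quot.ind
        rfl
      right_inv := fun f => rfl }
  have := Fintype.ofFinite (Quot fun x y : C => y = p x ∨ y = G.arc x)
  rw [← e.finrank_eq, Module.finrank_fintype_fun_eq_card, Nat.card_eq_fintype_card]

open PartialMatrix

/-- The sum of a constant and a linear combination of potentials of the edges in `T`. -/
def potentialSum (φ : E → C → ZMod 2) (T : Finset E) :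
    (ZMod 2 × ({e // e ∈ T} → ZMod 2)) →ₗ[ZMod 2] (C → ZMod 2) where
  toFun q x := q.1 + ∑ t, q.2 t * φ t x
  map_add' q r := by
    ext x
    simp only [Prod.fst_add, Prod.snd_add, Pi.add_apply, add_mul, Finset.sum_add_distrib]
    ring
  map_smul' c q := by
    ext x
    simp only [Prod.smul_fst, Prod.smul_snd, Pi.smul_apply, smul_eq_mul, RingHom.id_apply,
      mul_add, Finset.mul_sum, mul_assoc]

theorem potentialSum_apply (φ : E → C → ZMod 2) (T : Finset E)
    (q : ZMod 2 × ({e // e ∈ T} → ZMod 2)) (x : C) :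
    potentialSum φ T q x = q.1 + ∑ t, q.2 t * φ t x := rfl

theorem potentialSum_arc [DecidableEq E] {φ : E → C → ZMod 2}
    (hφ : ∀ e, G.IsPotential e (φ e)) {T : Finset E}
    (q : ZMod 2 × ({e // e ∈ T} → ZMod 2)) (x : C) :
    potentialSum φ T q (G.arc x) = potentialSum φ T q x := by
  simp only [potentialSum_apply, (hφ _).arc]

theorem potentialSum_seg [DecidableEq E] {φ : E → C → ZMod 2}
    (hφ : ∀ e, G.IsPotential e (φ e)) {T : Finset E}
    (q : ZMod 2 × ({e // e ∈ T} → ZMod 2)) (x : C) :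
    potentialSum φ T q (G.seg x) =
      potentialSum φ T q x + if h : G.edge x ∈ T then q.2 ⟨G.edge x, h⟩ else 0 := by
  simp only [potentialSum_apply, (hφ _).seg, mul_add, Finset.sum_add_distrib, mul_ite, mul_one,
    mul_zero, ← add_assoc]
  congr 1
  split_ifs with h
  · rw [Finset.sum_eq_single (⟨G.edge x, h⟩ : {e // e ∈ T})]
    · simp
    · exact fun t _ ht => if_neg fun he => ht (Subtype.ext he.symm)
    · exact fun h => absurd (Finset.mem_univ _) h
  · exact Finset.sum_eq_zero fun t _ => if_neg fun (he : G.edge x = t) => h (he ▸ t.2)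

/-- Following a side adds a row of the adjacency matrix applied to the coefficients; a diagonal is a
side followed by a segment, whose extra jump is the contribution of `I_D`. -/
theorem IsBouquet.potentialSum_pairing [Fintype E] [DecidableEq E] (hG : G.IsBouquet)
    {φ : E → C → ZMod 2} (hφ : ∀ e, G.IsPotential e (φ e)) {T D : Finset E}
    (q : ZMod 2 × ({e // e ∈ T} → ZMod 2)) (x : C) :
    potentialSum φ T q (G.pairing T D x) = potentialSum φ T q x +
      if h : G.edge x ∈ T then
        (principal (G.intersectionGraft.adjMatrix + diagInd (ZMod 2) D) T).mulVec q.2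
          ⟨G.edge x, h⟩
      else 0 := by
  have hside : potentialSum φ T q (G.side x) = potentialSum φ T q x +
      ∑ t : {e // e ∈ T}, G.intersectionGraft.adjMatrix (G.edge x) t * q.2 t := by
    simp only [hG.adjMatrix_apply (hφ _), potentialSum_apply]
    rw [add_assoc, ← Finset.sum_add_distrib]
    congr 1
    refine Finset.sum_congr rfl fun t _ => ?_
    have : ∀ a b c : ZMod 2, a * b = a * c + (c + b) * a := by decide
    exact this _ _ _
  by_cases h : G.edge x ∈ T
  · have hd : (principal (G.intersectionGraft.adjMatrix + diagInd (ZMod 2) D) T).mulVec q.2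
          ⟨G.edge x, h⟩ =
        (∑ t : {e // e ∈ T}, G.intersectionGraft.adjMatrix (G.edge x) t * q.2 t) +
          if G.edge x ∈ D then q.2 ⟨G.edge x, h⟩ else 0 := by
      simp only [Matrix.mulVec, dotProduct, principal, Matrix.submatrix_apply, Matrix.add_apply,
        add_mul, Finset.sum_add_distrib, diagInd, Matrix.diagonal_apply]
      congr 1
      rw [Finset.sum_eq_single (⟨G.edge x, h⟩ : {e // e ∈ T})]
      · simp
      · intro t _ ht
        rw [if_neg fun he => ht (Subtype.ext he.symm), zero_mul]
      · exact fun h => absurd (Finset.mem_univ _) h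
    rw [dif_pos h, hd, pairing, if_pos h, ← add_assoc, ← hside]
    split_ifs with hD
    · rw [potentialSum_seg hφ, dif_pos (by rwa [edge_side])]
      simp only [edge_side]
    · rw [add_zero]
  · rw [dif_neg h, pairing, if_neg h, potentialSum_seg hφ, dif_neg h]

theorem IsBouquet.potentialSum_mem_invariants [Fintype E] [DecidableEq E] (hG : G.IsBouquet)
    {φ : E → C → ZMod 2} (hφ : ∀ e, G.IsPotential e (φ e)) {T D : Finset E}
    (q : ZMod 2 × ({e // e ∈ T} → ZMod 2)) :
    potentialSum φ T q ∈ G.invariants (G.pairing T D) ↔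
      (principal (G.intersectionGraft.adjMatrix + diagInd (ZMod 2) D) T).mulVec q.2 = 0 := by
  constructor
  · intro h
    ext ⟨e, he⟩
    obtain ⟨x, rfl⟩ := G.edge_surjective e
    have h1 := (h x).2
    rw [hG.potentialSum_pairing hφ, dif_pos he, add_eq_left] at h1
    exact h1
  · refine fun h x => ⟨potentialSum_arc hφ q x, ?_⟩
    rw [hG.potentialSum_pairing hφ, h]
    simp

theorem potentialSum_injective [DecidableEq E] [Nonempty C] {φ : E → C → ZMod 2}
    (hφ : ∀ e, G.IsPotential e (φ e)) {T : Finset E} :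
    Function.Injective (potentialSum φ T) := by
  rw [← LinearMap.ker_eq_bot, LinearMap.ker_eq_bot']
  rintro ⟨c, h⟩ hq
  have h0 : h = 0 := by
    ext ⟨e, he⟩
    obtain ⟨x, rfl⟩ := G.edge_surjective e
    have h1 := potentialSum_seg hφ (c, h) x
    rw [hq, dif_pos he] at h1
    simpa using h1.symm
  subst h0
  obtain ⟨x⟩ := ‹Nonempty C›
  have := congrFun hq x
  simp only [potentialSum_apply, Pi.zero_apply, zero_mul, Finset.sum_const_zero, add_zero] at this
  rw [this]
  rfl

/-- The pairing carries one segment of a ribbon in `T` to the other, so an invariant function has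
equal jumps at both; outside `T` it has none. Subtracting the potentials with these jumps as
coefficients leaves a function constant along segments and arcs, hence constant. -/
theorem IsBouquet.exists_potentialSum_eq [DecidableEq E] [Nonempty C] (hG : G.IsBouquet)
    {φ : E → C → ZMod 2} (hφ : ∀ e, G.IsPotential e (φ e)) {T D : Finset E} {f : C → ZMod 2}
    (hf : f ∈ G.invariants (G.pairing T D)) : ∃ q, potentialSum φ T q = f := by
  have hjump : ∀ x, G.edge x ∈ T → f (G.side x) + f (G.seg (G.side x)) = f x + f (G.seg x) := by
    intro x hx
    have h1 := (hf x).2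
    have h2 := (hf (G.seg x)).2
    simp only [pairing, edge_seg, hx, if_true] at h1 h2
    rw [← G.seg_side] at h2
    split_ifs at h1 h2
    · rw [G.seg_seg] at h2
      rw [h1, h2, add_comm]
    · rw [h1, h2]
  choose r hr using G.edge_surjective
  have hjump' : ∀ x, G.edge x ∈ T →
      f (r (G.edge x)) + f (G.seg (r (G.edge x))) = f x + f (G.seg x) := by
    intro x hx
    rcases (G.edge_eq_iff x (r (G.edge x))).1 (hr _).symm with h | h | h | h <;> rw [h]
    · rw [G.seg_seg, add_comm]
    · exact hjump x hx
    · rw [G.seg_seg, add_comm, hjump x hx]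
  let h : {e // e ∈ T} → ZMod 2 := fun t => f (r t) + f (G.seg (r t))
  obtain ⟨x₀⟩ := ‹Nonempty C›
  have hconst := hG.eq_of_invariant (fun x => f x - potentialSum φ T (0, h) x) (fun x => by
      rw [potentialSum_seg hφ]
      split_ifs with hx
      · have e1 := hjump' x hx
        have e2 : ∀ a b c : ZMod 2, b - (c + (a + b)) = a - c := by decide
        simp only [h]
        rw [e1, e2]
      · have e1 := (hf x).2
        rw [pairing, if_neg hx] at e1
        rw [e1, add_zero])
    (fun x => by rw [(hf x).1, potentialSum_arc hφ]) x₀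
  refine ⟨(f x₀ - potentialSum φ T (0, h) x₀, h), ?_⟩
  ext x
  have := hconst x
  simp only [potentialSum_apply] at this ⊢
  rw [this]
  ring

theorem finrank_ker_mulVecLin {V : Type*} [Fintype V] (M : Matrix V V (ZMod 2)) :
    (Module.finrank (ZMod 2) (LinearMap.ker M.mulVecLin) : ℤ) = corank M := by
  have := M.mulVecLin.finrank_range_add_finrank_ker
  rw [Module.finrank_fintype_fun_eq_card] at this
  rw [corank, Matrix.rank]
  omega

/-- The number of closed curves made of vertex arcs and pairs of corners, in a bouquet. -/
theorem IsBouquet.card_quot_pairing [Fintype E] [DecidableEq E] [Nonempty C] (hG : G.IsBouquet) (T D : Finset E) :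
    (Nat.card (Quot fun x y : C => y = G.pairing T D x ∨ y = G.arc x) : ℤ) =
      1 + corank (principal (G.intersectionGraft.adjMatrix + diagInd (ZMod 2) D) T) := by
  have := G.finite_corners
  choose φ hφ using hG.exists_isPotential
  set M := principal (G.intersectionGraft.adjMatrix + diagInd (ZMod 2) D) T
  have hmem : ∀ q : ZMod 2 × LinearMap.ker M.mulVecLin,
      potentialSum φ T (q.1, q.2) ∈ G.invariants (G.pairing T D) := fun q =>
    (hG.potentialSum_mem_invariants hφ _).2 q.2.2
  -- The factor `ZMod 2` holds the additive constants and yields the summand `1` of the count.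
  let Ψ : (ZMod 2 × LinearMap.ker M.mulVecLin) →ₗ[ZMod 2] G.invariants (G.pairing T D) :=
    ((potentialSum φ T).comp
      (LinearMap.prodMap LinearMap.id (LinearMap.ker M.mulVecLin).subtype)).codRestrict _ hmem
  have hΨ : Function.Bijective Ψ := by
    constructor
    · intro a b hab
      have h := potentialSum_injective hφ (congrArg Subtype.val hab)
      have h1 : (a.1, a.2.1) = (b.1, b.2.1) := h
      exact Prod.ext (Prod.ext_iff.1 h1).1 (Subtype.ext (Prod.ext_iff.1 h1).2)
    · rintro ⟨f, hf⟩
      obtain ⟨q, rfl⟩ := hG.exists_potentialSum_eq hφ hf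
      exact ⟨(q.1, ⟨q.2, (hG.potentialSum_mem_invariants hφ q).1 hf⟩), rfl⟩
  rw [← finrank_invariants, ← (LinearEquiv.ofBijective Ψ hΨ).finrank_eq, Module.finrank_prod,
    Module.finrank_self, Nat.cast_add, finrank_ker_mulVecLin, Nat.cast_one]

/-! ### Isolated vertices, connectedness and the Euler genus -/

theorem IsBouquet.isolated_eq_zero [Nonempty C] (hG : G.IsBouquet) : G.isolated = 0 := by
  have := (Nat.card_eq_one_iff_unique.1 hG).1
  by_contra h
  obtain ⟨x⟩ := ‹Nonempty C›
  have := Subsingleton.elim (Sum.inl (Quot.mk _ x) : G.Vertex) (Sum.inr ⟨0, Nat.pos_of_ne_zero h⟩)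
  cases this

theorem IsBouquet.isolated_eq_one [IsEmpty C] (hG : G.IsBouquet) : G.isolated = 1 := by
  have : IsEmpty (Quot fun x y : C => y = G.seg x ∨ y = G.arc x) :=
    ⟨fun q => (Quot.exists_rep q).elim fun x _ => isEmptyElim x⟩
  simpa [IsBouquet, Nat.card_sum] using hG

theorem IsBouquet.card_curves [Fintype E] [DecidableEq E] (hG : G.IsBouquet) (T D : Finset E) {p : C → C}
    (hp : ∀ x, p x = G.pairing T D x) :
    (Nat.card ((Quot fun x y : C => y = p x ∨ y = G.arc x) ⊕ Fin G.isolated) : ℤ) =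
      1 + corank (principal (G.intersectionGraft.adjMatrix + diagInd (ZMod 2) D) T) := by
  obtain rfl : p = G.pairing T D := funext hp
  have := G.finite_corners
  rcases isEmpty_or_nonempty C with hC | hC
  · have hE : IsEmpty E := ⟨fun e => (G.edge_surjective e).elim fun x _ => isEmptyElim x⟩
    -- Without edges the only curve is the boundary of the isolated vertex, and the matrix is empty.
    have : IsEmpty (Quot fun x y : C => y = G.pairing T D x ∨ y = G.arc x) :=
      ⟨fun q => (Quot.exists_rep q).elim fun x _ => isEmptyElim x⟩
    have : IsEmpty {e // e ∈ T} := ⟨fun e => isEmptyElim e.1⟩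
    rw [hG.isolated_eq_one, Nat.card_sum, Nat.card_of_isEmpty, Nat.card_fin, ← finrank_ker_mulVecLin,
      Module.finrank_zero_of_subsingleton]
    simp
  · rw [hG.isolated_eq_zero, Nat.card_sum, Nat.card_fin, add_zero, hG.card_quot_pairing]

/-- A ribbon graph with the same corners and vertex arcs as a bouquet, whose segments and sides
generate those of the bouquet, is connected. -/
theorem IsBouquet.card_component [Finite E] (hG : G.IsBouquet) {H : RibbonGraph C E}
    (harc : H.arc = G.arc) (hiso : H.isolated = G.isolated)
    (hseg : ∀ x, G.seg x = H.seg x ∨ G.seg x = H.side x ∨ G.seg x = H.seg (H.side x)) :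
    Nat.card H.Component = 1 := by
  have := G.finite_corners
  rcases isEmpty_or_nonempty C with hC | ⟨⟨x₀⟩⟩
  · have : IsEmpty (Quot fun x y : C => y = H.seg x ∨ y = H.side x ∨ y = H.arc x) :=
      ⟨fun q => (Quot.exists_rep q).elim fun x _ => isEmptyElim x⟩
    rw [Nat.card_sum, Nat.card_of_isEmpty, Nat.card_fin, hiso, hG.isolated_eq_one]
  · have : Nonempty C := ⟨x₀⟩
    rw [Nat.card_sum, Nat.card_fin, hiso, hG.isolated_eq_zero, add_zero,
      Nat.card_eq_one_iff_unique]
    let π : C → Quot fun x y : C => y = H.seg x ∨ y = H.side x ∨ y = H.arc x := Quot.mk _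
    have h1 : ∀ x, π (H.seg x) = π x := fun x => Eq.symm (Quot.sound (Or.inl rfl))
    have h2 : ∀ x, π (H.side x) = π x := fun x => Eq.symm (Quot.sound (Or.inr (Or.inl rfl)))
    have h3 : ∀ x, π (G.arc x) = π x := fun x =>
      Eq.symm (Quot.sound (Or.inr (Or.inr (congrFun harc.symm x))))
    have h4 : ∀ x, π (G.seg x) = π x := fun x => by
      rcases hseg x with h | h | h <;> rw [h] <;> simp only [h1, h2]
    refine ⟨⟨fun a b => ?_⟩, ⟨π x₀⟩⟩
    induction a using Quot.ind
    induction b using Quot.ind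
    exact hG.eq_of_invariant π h4 h3 _ _

/-- The Euler genus of a ribbon graph obtained from a bouquet by choosing, for every ribbon, which
pairs of corners are its segments and which are its sides. -/
theorem IsBouquet.eulerGenus_eq [Fintype E] [DecidableEq E] (hG : G.IsBouquet) {H : RibbonGraph C E}
    (harc : H.arc = G.arc) (hiso : H.isolated = G.isolated)
    (hgen : ∀ x, G.seg x = H.seg x ∨ G.seg x = H.side x ∨ G.seg x = H.seg (H.side x))
    (T D T' D' : Finset E) (hseg : ∀ x, H.seg x = G.pairing T D x)
    (hside : ∀ x, H.side x = G.pairing T' D' x) :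
    H.eulerGenus = Fintype.card E
      - corank (principal (G.intersectionGraft.adjMatrix + diagInd (ZMod 2) D) T)
      - corank (principal (G.intersectionGraft.adjMatrix + diagInd (ZMod 2) D') T') := by
  have h1 := hG.card_curves T D hseg
  have h2 := hG.card_curves T' D' hside
  rw [← harc, ← hiso] at h1 h2
  rw [eulerGenus, eulerChar, hG.card_component harc hiso hgen, h1, h2, Nat.card_eq_fintype_card]
  ring

end RibbonGraph

/-! ### Coranks and the five operators -/

namespace PartialMatrix

variable {V K : Type*} [Field K]

theorem corank_principal (M : Matrix V V K) (A : Finset V) :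
    corank (principal M A) = A.card - (principal M A).rank := by
  rw [corank, Fintype.card_coe]

theorem corank_principal_univ [Fintype V] (M : Matrix V V K) :
    corank (principal M Finset.univ) = Fintype.card V - M.rank := by
  rw [corank_principal, Finset.card_univ, principal]
  congr 2
  exact M.rank_submatrix (Equiv.subtypeUnivEquiv Finset.mem_univ)
    (Equiv.subtypeUnivEquiv Finset.mem_univ)

theorem corank_principal_empty (M : Matrix V V K) : corank (principal M ∅) = 0 := by
  have : IsEmpty {x // x ∈ (∅ : Finset V)} := ⟨fun x => Finset.notMem_empty _ x.2⟩
  have := (principal M ∅).rank_le_card_width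
  rw [corank_principal]
  simp at this ⊢
  exact this

theorem diagInd_empty [DecidableEq V] : diagInd K (∅ : Finset V) = 0 := by
  simp [diagInd]

end PartialMatrix

open PartialMatrix in
-- Each operator amounts to two pairings: `(T, D)` for the new segments and `(T', D')` for the new
-- sides. With the second set `Aᶜ`, splitting `|E|` as `|A| + |Aᶜ|` turns both coranks into ranks;
-- with the second set `univ`, only that corank is absorbed into a rank.
theorem RibbonGraph.IsBouquet.eulerGenus_applyWord {C : Type u} {E : Type v} [Fintype E]
    [DecidableEq E] {B : RibbonGraph C E} (hB : B.IsBouquet) (t : Twuality) (A : Finset E) :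
    (B.applyWord A t.word).eulerGenus = exponent t B.intersectionGraft.adjMatrix A := by
  have hc : (Fintype.card E : ℤ) = A.card + Aᶜ.card := by
    rw [Finset.card_compl, Nat.cast_sub (Finset.card_le_univ A)]
    ring
  cases t
  · rw [hB.eulerGenus_eq (by rfl) (by rfl) (fun x => ?_) A ∅ Aᶜ ∅ (fun x => ?_) (fun x => ?_),
      diagInd_empty, add_zero, corank_principal, corank_principal, exponent, hc]
    · ring
    all_goals
      by_cases h : B.edge x ∈ A <;>
      simp [h, Twuality.word, applyWord, applyLetter, partialDual, pairing]
  · rw [hB.eulerGenus_eq (by rfl) (by rfl) (fun x => ?_) ∅ ∅ Finset.univ A (fun x => ?_)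
        (fun x => ?_),
      corank_principal_empty, corank_principal_univ, exponent]
    · ring
    all_goals
      by_cases h : B.edge x ∈ A <;>
      simp [h, Twuality.word, applyWord, applyLetter, partialPetrial, pairing]
  · rw [hB.eulerGenus_eq (by rfl) (by rfl) (fun x => ?_) A A Aᶜ ∅ (fun x => ?_) (fun x => ?_),
      diagInd_empty, add_zero, corank_principal, corank_principal, exponent, hc]
    · ring
    all_goals
      by_cases h : B.edge x ∈ A <;>
      simp [h, Twuality.word, applyWord, applyLetter, partialDual, partialPetrial, pairing]
  -- After dualizing, segments and sides are exchanged on `A`; the half-twist then turns the new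
  -- sides there into diagonals.
  · rw [hB.eulerGenus_eq (by rfl) (by rfl) (fun x => ?_) A ∅ Finset.univ A (fun x => ?_)
        (fun x => ?_),
      diagInd_empty, add_zero, corank_principal_univ, exponent]
    · ring
    all_goals
      by_cases h : B.edge x ∈ A <;>
      simp [h, Twuality.word, applyWord, applyLetter, partialDual, partialPetrial, pairing,
        edge_seg, edge_side, B.seg_side, B.side_side]
  · rw [hB.eulerGenus_eq (by rfl) (by rfl) (fun x => ?_) A A Finset.univ ∅ (fun x => ?_)
        (fun x => ?_),
      diagInd_empty, add_zero, corank_principal_univ, exponent]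
    · ring
    all_goals
      by_cases h : B.edge x ∈ A <;>
      simp [h, Twuality.word, applyWord, applyLetter, partialDual, partialPetrial, pairing,
        edge_seg, edge_side, B.seg_side, B.seg_seg, B.side_side]

theorem theorem2p3 {C : Type u} {E : Type v} [Fintype E] [DecidableEq E]
    (B : RibbonGraph C E) (hB : B.IsBouquet) (t : Twuality) :
    B.partialPoly t = B.intersectionGraft.partialPoly t :=
  Finset.sum_congr rfl fun A _ => congrArg LaurentPolynomial.T (hB.eulerGenus_applyWord t A)
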